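/- **Proposition.** There are absolute constants $C>0$ and $c>0$ such that the following holds. Let $n,d\ge 1$ be integers, let $\epsilon>0$ be real, and set $\delta=\epsilon/4$. Let $\Sigma$ be a symmetric positive definite real $d\times d$ matrix, and let $Z_1,\dots,Z_n\sim N(0,\Sigma)$ be independent and identically distributed random vectors in $\mathbb{R}^d$. If $$n\;\ge\; \frac{C\,d\,\log n}{\epsilon^2},$$ then with probability at least $1-\exp(-c\,\epsilon^2 n)$ the samples $(Z_i)_{i=1}^n$ satisfy $(\epsilon,\delta)$-strong anti-concentration, i.e. for all $\beta\in\mathbb{R}^d$ simultaneously, $$\left|\left\{i\in\{1,\dots,n\}: |\langle Z_i,\beta\rangle| < \frac{\delta}{\sqrt n}\,\|Z\beta\|_2\right\}\right|\le \epsilon n,$$ where $Z$ is the $n\times d$ matrix with rows $Z_1,\dots,Z_n$. -/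

import Mathlib

open MeasureTheory ProbabilityTheory

/-- The `n × d` matrix whose rows are the samples `z 0, …, z (n - 1)`. -/
def sampleMatrix {n d : ℕ} (z : Fin n → EuclideanSpace ℝ (Fin d)) :
    Matrix (Fin n) (Fin d) ℝ :=
  Matrix.of fun i j => z i j

/-- `(ε, δ)`-strong anti-concentration of samples `z 0, …, z (n - 1)` in `ℝ^d`: for every
`β ∈ ℝ^d`, at most `ε n` of the indices `i` satisfy `|⟨z i, β⟩| < (δ / √n) ‖Z β‖₂`, where `Z` is
the matrix with rows `z i` and the norm is the Euclidean norm on `ℝ^n`. -/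
def StrongAntiConcentration {n d : ℕ} (ε δ : ℝ) (z : Fin n → EuclideanSpace ℝ (Fin d)) : Prop :=
  ∀ β : EuclideanSpace ℝ (Fin d),
    (Set.ncard {i : Fin n | |inner ℝ (z i) β| <
      δ / √(n : ℝ) * ‖WithLp.toLp 2 (Matrix.mulVec (sampleMatrix z) β.ofLp)‖} : ℝ) ≤ ε * n

/-!
Write `Z i = S^{1/2} W i` with `W i` standard Gaussian; strong anti-concentration of `Z` follows
from that of `W` after the substitution `β ↦ S^{1/2} β` (`exists_whitening`,
`StrongAntiConcentration.of_inner_eq`). By homogeneity only unit vectors `β` matter.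

For a fixed unit vector `γ` the numbers `⟨W i, γ⟩` are independent standard Gaussians. Chernoff's
bound for `χ²` variables gives `∑ i, ⟨W i, γ⟩² ≤ 3 n` outside an event of probability
`exp (-2 n / 5)` (`measureReal_sum_sq_gaussian_ge_le`). Since `|⟨W i, γ⟩| < 5 ε / 8` has probability
at most `ε / 2`, Hoeffding's inequality shows that more than `ε n` indices have this property with
probability at most `exp (-ε² n / 2)` (`measureReal_ncard_ge_le`).

Both bounds are imposed on an `ε / (16 √n)`-net of the sphere. They then control the operator norm
of the sample matrix by `2 √n`, which in turn is enough to pass from the net to the whole sphere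
(`strongAntiConcentration_of_net`). The net has at most `(48 √n / ε) ^ d` points
(`exists_finset_net_sphere`), which is `exp (O (d log n))` because the hypothesis forces
`1 / ε ≤ √n`; so the union bound costs only a fraction of the exponent `ε² n` once `C` is large
(`measureReal_not_strongAntiConcentration_stdGaussian_le`). The case `ε ≥ 1` is trivial, and so is
`n = 1`, where the hypothesis is void.
-/

/-! ### Nets of the unit sphere -/

/-- Volume comparison: the balls of radius `η / 2` around the points of `s` are disjoint and lie in
the ball of radius `1 + η / 2`. -/
lemma card_le_of_separated_of_norm_le_one {E : Type*} [NormedAddCommGroup E] [NormedSpace ℝ E]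
    [FiniteDimensional ℝ E] {η : ℝ} (hη : 0 < η) (s : Finset E) (hs : ∀ x ∈ s, ‖x‖ ≤ 1)
    (h : ∀ x ∈ s, ∀ y ∈ s, x ≠ y → η ≤ dist x y) :
    (s.card : ℝ) ≤ (1 + 2 / η) ^ Module.finrank ℝ E := by
  borelize E
  let μ : Measure E := Measure.addHaar
  have hδ : 0 < η / 2 := by positivity
  have hρ : 0 < 1 + η / 2 := by positivity
  have hdisj : Set.Pairwise (s : Set E)
      (Function.onFun Disjoint fun x => Metric.ball x (η / 2)) := fun x hx y hy hxy =>
    Metric.ball_disjoint_ball (by rw [add_halves]; exact h x hx y hy hxy)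
  have hsub : (⋃ x ∈ s, Metric.ball x (η / 2)) ⊆ Metric.ball (0 : E) (1 + η / 2) := by
    refine Set.iUnion₂_subset fun x hx => Metric.ball_subset_ball' ?_
    rw [dist_zero_right]
    linarith [hs x hx]
  have hvol : (s.card : ENNReal) * ENNReal.ofReal ((η / 2) ^ Module.finrank ℝ E)
        * μ (Metric.ball 0 1)
      ≤ ENNReal.ofReal ((1 + η / 2) ^ Module.finrank ℝ E) * μ (Metric.ball 0 1) :=
    calc
      _ = μ (⋃ x ∈ s, Metric.ball x (η / 2)) := by
        rw [measure_biUnion_finset hdisj fun _ _ => measurableSet_ball]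
        simp only [μ.addHaar_ball_of_pos _ hδ, Finset.sum_const, nsmul_eq_mul, mul_assoc]
      _ ≤ μ (Metric.ball (0 : E) (1 + η / 2)) := measure_mono hsub
      _ = _ := μ.addHaar_ball_of_pos _ hρ
  have hcard : (s.card : ENNReal) * ENNReal.ofReal ((η / 2) ^ Module.finrank ℝ E)
      ≤ ENNReal.ofReal ((1 + η / 2) ^ Module.finrank ℝ E) :=
    (ENNReal.mul_le_mul_iff_left (Metric.measure_ball_pos _ _ zero_lt_one).ne'
      measure_ball_lt_top.ne).1 hvol
  have hreal := ENNReal.toReal_le_of_le_ofReal (pow_nonneg hρ.le _) hcard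
  rw [ENNReal.toReal_mul, ENNReal.toReal_natCast,
    ENNReal.toReal_ofReal (pow_nonneg hδ.le _), ← le_div_iff₀ (pow_pos hδ _), ← div_pow] at hreal
  rwa [show (1 + η / 2) / (η / 2) = 1 + 2 / η by field_simp; ring] at hreal

/-- The unit sphere has an `η`-net of at most `(3 / η) ^ d` points. -/
lemma exists_finset_net_sphere {E : Type*} [NormedAddCommGroup E] [NormedSpace ℝ E]
    [FiniteDimensional ℝ E] {η : ℝ} (hη : 0 < η) (hη1 : η ≤ 1) :
    ∃ N : Finset E, (N.card : ℝ) ≤ (3 / η) ^ Module.finrank ℝ E ∧ (∀ x ∈ N, ‖x‖ = 1) ∧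
      ∀ x : E, ‖x‖ = 1 → ∃ y ∈ N, ‖x - y‖ ≤ η := by
  let ηn : NNReal := ⟨η, hη.le⟩
  let A : Set E := Metric.sphere 0 1
  have hcard : ∀ s : Finset E, (s : Set E) ⊆ A → Metric.IsSeparated (ηn : ENNReal) (s : Set E) →
      (s.card : ℝ) ≤ (3 / η) ^ Module.finrank ℝ E := by
    intro s hsA hsep
    refine (card_le_of_separated_of_norm_le_one hη s (fun x hx => ?_) fun x hx y hy hxy => ?_).trans
      ?_
    · exact (mem_sphere_zero_iff_norm.1 (hsA hx)).le
    · have : (ηn : ENNReal) < edist x y := hsep hx hy hxy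
      rw [edist_nndist, ENNReal.coe_lt_coe] at this
      exact this.le
    · refine pow_le_pow_left₀ (by positivity) ?_ _
      rw [le_div_iff₀ hη, add_mul, div_mul_cancel₀ _ hη.ne']
      linarith
  obtain ⟨K, hK⟩ := exists_nat_gt ((3 / η) ^ Module.finrank ℝ E)
  have hpack : Metric.packingNumber ηn A ≠ ⊤ := by
    refine ne_top_of_le_ne_top (ENat.natCast_ne_top K)
      (iSup_le fun C => iSup_le fun hCA => iSup_le fun hCsep => ?_)
    by_contra! hlt
    obtain ⟨t, htC, ht⟩ := Set.exists_subset_encard_eq hlt.le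
    have htfin : t.Finite := Set.finite_of_encard_eq_coe ht
    have := hcard htfin.toFinset (by simpa using htC.trans hCA)
      (by simpa using hCsep.subset htC)
    rw [htfin.encard_eq_coe_toFinset_card, ENat.natCast_inj] at ht
    rw [ht] at this
    exact absurd this (not_le.2 hK)
  have hfin : (Metric.maximalSeparatedSet ηn A).Finite := by
    rw [← Set.encard_ne_top_iff, Metric.encard_maximalSeparatedSet hpack]
    exact hpack
  refine ⟨hfin.toFinset, hcard _ ?_ ?_, fun x hx => ?_, fun x hx => ?_⟩
  · simpa using Metric.maximalSeparatedSet_subset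
  · simpa using Metric.isSeparated_maximalSeparatedSet
  · exact mem_sphere_zero_iff_norm.1 (Metric.maximalSeparatedSet_subset (hfin.mem_toFinset.1 hx))
  · obtain ⟨y, hy, hxy⟩ :=
      Metric.isCover_maximalSeparatedSet hpack (mem_sphere_zero_iff_norm.2 hx)
    refine ⟨y, hfin.mem_toFinset.2 hy, ?_⟩
    rw [← dist_eq_norm]
    have hxy' : edist x y ≤ ηn := hxy
    rw [edist_nndist, ENNReal.coe_le_coe] at hxy'
    exact hxy'

/-! ### One-dimensional Gaussian estimates -/

/-- The standard Gaussian density is at most `1 / √(2π) ≤ 2 / 5`. -/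
lemma gaussianReal_real_abs_lt_le {t : ℝ} (ht : 0 ≤ t) :
    (gaussianReal 0 1).real {x | |x| < t} ≤ 4 / 5 * t := by
  have hset : {x : ℝ | |x| < t} = Set.Ioo (-t) t := by
    ext x
    simp [abs_lt]
  have hpdf : ∀ x, gaussianPDFReal 0 1 x ≤ 2 / 5 := fun x => by
    rw [gaussianPDFReal]
    have h1 : (√(2 * Real.pi * (1 : NNReal)))⁻¹ ≤ 2 / 5 := by
      rw [inv_le_comm₀ (by positivity) (by norm_num)]
      refine Real.le_sqrt_of_sq_le ?_
      push_cast
      linarith [Real.pi_gt_d2]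
    have h2 : Real.exp (-(x - 0) ^ 2 / (2 * (1 : NNReal))) ≤ 1 := by
      rw [Real.exp_le_one_iff, neg_div]
      exact neg_nonpos.2 (by positivity)
    calc _ ≤ 2 / 5 * (1 : ℝ) := mul_le_mul h1 h2 (Real.exp_pos _).le (by norm_num)
      _ = 2 / 5 := mul_one _
  rw [hset, measureReal_def, gaussianReal_apply_eq_integral _ one_ne_zero, ENNReal.toReal_ofReal
    (integral_nonneg fun x => gaussianPDFReal_nonneg _ _ _)]
  calc ∫ x in Set.Ioo (-t) t, gaussianPDFReal 0 1 x ≤ ∫ _ in Set.Ioo (-t) t, (2 / 5 : ℝ) :=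
        integral_mono (integrable_gaussianPDFReal _ _).restrict (integrable_const _) hpdf
    _ = 4 / 5 * t := by
        rw [setIntegral_const, Real.volume_real_Ioo_of_le (by linarith), smul_eq_mul]
        ring

/-- The Laplace transform of the `χ²` distribution with one degree of freedom at `1 / 4`. -/
lemma mgf_sq_gaussianReal_quarter : mgf (fun x => x ^ 2) (gaussianReal 0 1) (1 / 4) = √2 := by
  rw [mgf, integral_gaussianReal_eq_integral_smul one_ne_zero]
  have h : ∀ x : ℝ, gaussianPDFReal 0 1 x • Real.exp (1 / 4 * x ^ 2)
      = (√(2 * Real.pi))⁻¹ * Real.exp (-(1 / 4) * x ^ 2) := fun x => by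
    rw [gaussianPDFReal, smul_eq_mul, mul_assoc, ← Real.exp_add]
    simp only [NNReal.coe_one, mul_one, sub_zero]
    ring_nf
  simp_rw [h]
  rw [integral_const_mul, integral_gaussian, inv_mul_eq_div,
    ← Real.sqrt_div (by positivity)]
  congr 1
  field_simp
  norm_num

/-! ### Concentration for independent Gaussians -/

section

variable {Ω : Type*} [MeasurableSpace Ω] {P : Measure Ω} {n : ℕ} {Y : Fin n → Ω → ℝ}

/-- Chernoff's bound with parameter `1 / 4`: it gives `(√2 * exp (-3 / 4)) ^ n`. -/
lemma measureReal_sum_sq_gaussian_ge_le [IsProbabilityMeasure P]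
    (hlaw : ∀ i, HasLaw (Y i) (gaussianReal 0 1) P) (hind : iIndepFun Y P) :
    P.real {ω | 3 * (n : ℝ) ≤ ∑ i, Y i ω ^ 2} ≤ Real.exp (-(2 / 5 * n)) := by
  have hmeas : ∀ i, AEMeasurable (fun ω => Y i ω ^ 2) P := fun i =>
    (hlaw i).aemeasurable.pow_const 2
  have hind2 : iIndepFun (fun i ω => Y i ω ^ 2) P :=
    hind.comp (fun _ x => x ^ 2) fun _ => by fun_prop
  have hmgf1 : ∀ i, mgf (fun ω => Y i ω ^ 2) P (1 / 4) = √2 := fun i => by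
    rw [← mgf_sq_gaussianReal_quarter, ← (hlaw i).map_eq, mgf_map (hlaw i).aemeasurable
      (by fun_prop)]
    rfl
  have hmgf : mgf (∑ i, fun ω => Y i ω ^ 2) P (1 / 4) = √2 ^ n := by
    rw [hind2.mgf_sum₀ hmeas, Finset.prod_congr rfl fun i _ => hmgf1 i]
    simp
  -- a non-integrable function would have Bochner integral `0`
  have hint : Integrable (fun ω => Real.exp (1 / 4 * (∑ i, fun ω => Y i ω ^ 2) ω)) P := by
    refine Integrable.of_integral_ne_zero ?_
    change mgf (∑ i, fun ω => Y i ω ^ 2) P (1 / 4) ≠ 0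
    rw [hmgf]
    positivity
  have hch := measure_ge_le_exp_mul_mgf (3 * (n : ℝ)) (by norm_num) hint
  rw [hmgf] at hch
  simp only [Finset.sum_apply] at hch
  refine hch.trans ?_
  have hsqrt : √2 ≤ Real.exp (7 / 20) := by
    rw [Real.sqrt_le_left (Real.exp_pos _).le, ← Real.exp_nat_mul,
      ← Real.log_le_iff_le_exp (by norm_num)]
    norm_num
    linarith [Real.log_two_lt_d9]
  calc _ ≤ Real.exp (-(1 / 4) * (3 * n)) * Real.exp (7 / 20) ^ n := by gcongr
    _ = _ := by
      rw [← Real.exp_nat_mul, ← Real.exp_add]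
      ring_nf

/-- Hoeffding's inequality for the number of indices with `Y i ∈ A`. -/
lemma measureReal_ncard_ge_le [IsProbabilityMeasure P] (hind : iIndepFun Y P)
    (hmeas : ∀ i, AEMeasurable (Y i) P) {A : Set ℝ} (hA : MeasurableSet A) {p r : ℝ}
    (hp : ∀ i, P.real {ω | Y i ω ∈ A} ≤ p) (hr : 0 ≤ r) :
    P.real {ω | (p + r) * n ≤ ({i | Y i ω ∈ A}.ncard : ℝ)} ≤ Real.exp (-(2 * r ^ 2 * n)) := by
  classical
  rcases Nat.eq_zero_or_pos n with rfl | hn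
  · simp
  let f : ℝ → ℝ := A.indicator 1
  have hf : Measurable f := measurable_one.indicator hA
  have hfm : ∀ i, AEMeasurable (fun ω => f (Y i ω)) P := fun i => hf.comp_aemeasurable (hmeas i)
  have hmean : ∀ i, ∫ ω, f (Y i ω) ∂P ≤ p := fun i => by
    refine le_of_eq_of_le ?_ (hp i)
    have hset : NullMeasurableSet {ω | Y i ω ∈ A} P := (hmeas i).nullMeasurableSet_preimage hA
    have : (fun ω => f (Y i ω)) = {ω | Y i ω ∈ A}.indicator 1 := by
      ext ω
      simp [f, Set.indicator_apply]
    rw [this, integral_indicator₀ hset]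
    simp
  have hsub : ∀ i ∈ Finset.univ, HasSubgaussianMGF
      (fun ω => f (Y i ω) - ∫ ω', f (Y i ω') ∂P) ((‖(1 : ℝ) - 0‖₊ / 2) ^ 2) P := fun i _ =>
    hasSubgaussianMGF_of_mem_Icc (hfm i) (ae_of_all _ fun ω => by
      by_cases h : Y i ω ∈ A <;> simp [f, h])
  have hind2 : iIndepFun (fun i ω => f (Y i ω) - ∫ ω', f (Y i ω') ∂P) P :=
    hind.comp (fun i x => f x - ∫ ω', f (Y i ω') ∂P) fun i => by fun_prop
  have key := HasSubgaussianMGF.measure_sum_ge_le_of_iIndepFun hind2 hsub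
    (ε := r * n) (by positivity)
  refine (measureReal_mono fun ω hω => ?_).trans (key.trans_eq ?_)
  · have hcount : ({i | Y i ω ∈ A}.ncard : ℝ) = ∑ i, f (Y i ω) := by
      simp [f, Set.ncard_eq_toFinset_card', Set.indicator_apply]
    have hω' : (p + r) * n ≤ ({i | Y i ω ∈ A}.ncard : ℝ) := hω
    change r * n ≤ ∑ i, (f (Y i ω) - ∫ ω', f (Y i ω') ∂P)
    have hsum : ∑ i, ∫ ω', f (Y i ω') ∂P ≤ n * p :=
      (Finset.sum_le_sum fun i _ => hmean i).trans_eq (by simp)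
    rw [Finset.sum_sub_distrib, ← hcount]
    linarith
  · congr 1
    simp
    field_simp

end

/-! ### Deterministic reductions -/

lemma sampleMatrix_mulVec_apply {n d : ℕ} (z : Fin n → EuclideanSpace ℝ (Fin d))
    (β : EuclideanSpace ℝ (Fin d)) (i : Fin n) :
    Matrix.mulVec (sampleMatrix z) β.ofLp i = inner ℝ (z i) β := by
  simp [Matrix.mulVec, dotProduct, sampleMatrix, PiLp.inner_apply, mul_comm]

/-- Strong anti-concentration only depends on the functions `β ↦ ⟨z i, β⟩` up to a common
reparametrization of `β`. -/
lemma StrongAntiConcentration.of_inner_eq {n d : ℕ} {ε δ : ℝ}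
    {z w : Fin n → EuclideanSpace ℝ (Fin d)} (hw : StrongAntiConcentration ε δ w)
    (T : EuclideanSpace ℝ (Fin d) → EuclideanSpace ℝ (Fin d))
    (h : ∀ i β, inner ℝ (z i) β = inner ℝ (w i) (T β)) : StrongAntiConcentration ε δ z := by
  intro β
  have hmul : Matrix.mulVec (sampleMatrix z) β.ofLp
      = Matrix.mulVec (sampleMatrix w) (T β).ofLp := by
    ext i
    rw [sampleMatrix_mulVec_apply, sampleMatrix_mulVec_apply, h]
  have := hw (T β)
  rw [← hmul] at this
  simpa only [h] using this

lemma strongAntiConcentration_of_one_le {n d : ℕ} {ε δ : ℝ} (hε : 1 ≤ ε)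
    (z : Fin n → EuclideanSpace ℝ (Fin d)) : StrongAntiConcentration ε δ z := by
  intro β
  have h : (Set.ncard {i : Fin n | |inner ℝ (z i) β| <
      δ / √(n : ℝ) * ‖WithLp.toLp 2 (Matrix.mulVec (sampleMatrix z) β.ofLp)‖} : ℝ) ≤ n := by
    have := Set.ncard_le_card {i : Fin n | |inner ℝ (z i) β| <
      δ / √(n : ℝ) * ‖WithLp.toLp 2 (Matrix.mulVec (sampleMatrix z) β.ofLp)‖}
    rw [Nat.card_fin] at this
    exact_mod_cast this
  nlinarith [(Nat.cast_nonneg n : (0 : ℝ) ≤ n)]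

/-- A single sample satisfies `|⟨z 0, β⟩| = ‖Z β‖`, so no index is counted when `δ ≤ 1`. -/
lemma strongAntiConcentration_one {d : ℕ} {ε δ : ℝ} (hε : 0 ≤ ε) (hδ : δ ≤ 1)
    (z : Fin 1 → EuclideanSpace ℝ (Fin d)) : StrongAntiConcentration ε δ z := by
  intro β
  have hempty : {i : Fin 1 | |inner ℝ (z i) β| <
      δ / √((1 : ℕ) : ℝ) * ‖WithLp.toLp 2 (Matrix.mulVec (sampleMatrix z) β.ofLp)‖} = ∅ := by
    ext i
    have hi : i = 0 := Subsingleton.elim _ _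
    subst hi
    have hnorm : ‖WithLp.toLp 2 (Matrix.mulVec (sampleMatrix z) β.ofLp)‖
        = |inner ℝ (z 0) β| := by
      simp [EuclideanSpace.norm_eq, sampleMatrix_mulVec_apply, Real.sqrt_sq_eq_abs]
    simp only [Set.mem_ofPred_eq, Set.mem_empty_iff_false, iff_false, not_lt, hnorm, Nat.cast_one,
      Real.sqrt_one, div_one]
    exact mul_le_of_le_one_left (abs_nonneg _) hδ
  rw [hempty]
  simpa using hε

/-- Passage from a net to the whole sphere. If `A β = (⟨w i, β⟩)ᵢ`, the bound `‖A γ‖² ≤ 3 n` on an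
`η`-net gives `‖A‖ ≤ √(3 n) + η ‖A‖`, hence `‖A‖ ≤ 2 √n`. An index counted for a unit vector `β`
then has `|⟨w i, β⟩| < ε / 2`, and replacing `β` by a point `γ` of the net changes `⟨w i, β⟩` by at
most `‖A‖ η ≤ ε / 8`. -/
lemma strongAntiConcentration_of_net {n d : ℕ} {ε : ℝ} (hn : 0 < n) (hε : 0 < ε) (hε1 : ε ≤ 1)
    (w : Fin n → EuclideanSpace ℝ (Fin d)) (N : Finset (EuclideanSpace ℝ (Fin d)))
    (hN : ∀ x : EuclideanSpace ℝ (Fin d), ‖x‖ = 1 → ∃ y ∈ N, ‖x - y‖ ≤ ε / (16 * √(n : ℝ)))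
    (hsq : ∀ γ ∈ N, ∑ i, inner ℝ (w i) γ ^ 2 ≤ 3 * (n : ℝ))
    (hcount : ∀ γ ∈ N, ({i | |inner ℝ (w i) γ| < 5 / 8 * ε}.ncard : ℝ) ≤ ε * n) :
    StrongAntiConcentration ε (ε / 4) w := by
  have hn1 : (1 : ℝ) ≤ n := by exact_mod_cast hn
  have hs1 : 1 ≤ √(n : ℝ) := Real.one_le_sqrt.2 hn1
  have hs0 : 0 < √(n : ℝ) := by linarith
  have hη0 : 0 < ε / (16 * √(n : ℝ)) := by positivity
  have hη : ε / (16 * √(n : ℝ)) ≤ 1 / 16 := by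
    rw [div_le_div_iff₀ (by positivity) (by norm_num)]
    linarith
  let A : EuclideanSpace ℝ (Fin d) →L[ℝ] EuclideanSpace ℝ (Fin n) :=
    LinearMap.toContinuousLinearMap (Matrix.toLpLin 2 2 (sampleMatrix w))
  have hA : ∀ β, A β = WithLp.toLp 2 (Matrix.mulVec (sampleMatrix w) β.ofLp) := fun β => rfl
  have hAi : ∀ β i, A β i = inner ℝ (w i) β := fun β i => by
    rw [hA]
    exact sampleMatrix_mulVec_apply w β i
  have hAN : ∀ γ ∈ N, ‖A γ‖ ≤ 7 / 4 * √(n : ℝ) := fun γ hγ => by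
    rw [EuclideanSpace.norm_eq, Real.sqrt_le_left (by positivity), mul_pow,
      Real.sq_sqrt (by positivity)]
    simp only [hAi, Real.norm_eq_abs, sq_abs]
    linarith [hsq γ hγ]
  have hAnorm : ‖A‖ ≤ 2 * √(n : ℝ) := by
    have h : ‖A‖ ≤ 7 / 4 * √(n : ℝ) + ‖A‖ * (1 / 16) := by
      refine A.opNorm_le_of_unit_norm (by positivity) fun x hx => ?_
      obtain ⟨y, hy, hxy⟩ := hN x hx
      calc ‖A x‖ = ‖A y + A (x - y)‖ := by rw [← map_add, add_sub_cancel]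
        _ ≤ ‖A y‖ + ‖A (x - y)‖ := norm_add_le _ _
        _ ≤ _ := add_le_add (hAN y hy) ((A.le_opNorm _).trans (by gcongr; exact hxy.trans hη))
    linarith
  intro β
  rw [← hA]
  rcases eq_or_ne β 0 with rfl | hβ
  · simp only [map_zero, norm_zero, mul_zero, inner_zero_right, abs_zero, lt_irrefl,
      Set.ofPred_false, Set.ncard_empty, Nat.cast_zero]
    positivity
  have hβ0 : 0 < ‖β‖ := norm_pos_iff.2 hβ
  obtain ⟨γ, hγ, hβγ⟩ := hN (‖β‖⁻¹ • β) (norm_smul_inv_norm hβ)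
  refine le_trans ?_ (hcount γ hγ)
  refine Nat.cast_le.2 (Set.ncard_le_ncard (fun i hi => ?_) (Set.toFinite _))
  have hi' : |inner ℝ (w i) β| < ε / 4 / √(n : ℝ) * ‖A β‖ := hi
  have hAβ : ε / 4 / √(n : ℝ) * ‖A β‖ ≤ ε / 2 * ‖β‖ :=
    calc _ ≤ ε / 4 / √(n : ℝ) * (2 * √(n : ℝ) * ‖β‖) := by
          gcongr
          exact (A.le_opNorm β).trans (by gcongr)
      _ = _ := by field_simp; norm_num
  have h1 : |inner ℝ (w i) (‖β‖⁻¹ • β)| < ε / 2 := by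
    rw [inner_smul_right, abs_mul, abs_of_pos (inv_pos.2 hβ0), inv_mul_lt_iff₀ hβ0]
    linarith
  have h2 : |inner ℝ (w i) (‖β‖⁻¹ • β - γ)| ≤ ε / 8 :=
    calc |inner ℝ (w i) (‖β‖⁻¹ • β - γ)| = ‖A (‖β‖⁻¹ • β - γ) i‖ := by
          rw [hAi, Real.norm_eq_abs]
      _ ≤ ‖A (‖β‖⁻¹ • β - γ)‖ := PiLp.norm_apply_le _ _
      _ ≤ 2 * √(n : ℝ) * (ε / (16 * √(n : ℝ))) := (A.le_opNorm _).trans (by gcongr)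
      _ = ε / 8 := by field_simp; norm_num
  rw [inner_sub_right] at h2
  change |inner ℝ (w i) γ| < 5 / 8 * ε
  rw [abs_lt] at h1 ⊢
  rw [abs_le] at h2
  constructor <;> linarith [h1.1, h1.2, h2.1, h2.2]

/-! ### Whitening and the union bound -/

lemma hasLaw_inner_stdGaussian {E : Type*} [NormedAddCommGroup E] [InnerProductSpace ℝ E]
    [FiniteDimensional ℝ E] [MeasurableSpace E] [BorelSpace E] {γ : E} (hγ : ‖γ‖ = 1) :
    HasLaw (fun x => inner ℝ x γ) (gaussianReal 0 1) (stdGaussian E) where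
  aemeasurable := by fun_prop
  map_eq := by
    have h := IsGaussian.map_eq_gaussianReal (μ := stdGaussian E) (innerSL ℝ γ)
    rw [integral_strongDual_stdGaussian, variance_dual_stdGaussian, innerSL_apply_norm, hγ] at h
    simp only [one_pow, Real.toNNReal_one] at h
    rw [← h]
    congr 1
    ext x
    exact real_inner_comm _ _

open scoped MatrixOrder in
/-- A Gaussian vector with positive definite covariance `S` is the image of a standard Gaussian
vector under the symmetric invertible map `S^{1/2}`. -/
lemma exists_whitening {d : ℕ} {S : Matrix (Fin d) (Fin d) ℝ} (hS : S.PosDef) :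
    ∃ R R' : EuclideanSpace ℝ (Fin d) →L[ℝ] EuclideanSpace ℝ (Fin d),
      (∀ x y, inner ℝ (R x) y = inner ℝ x (R y)) ∧ (∀ x, R (R' x) = x) ∧
      HasLaw R' (stdGaussian (EuclideanSpace ℝ (Fin d))) (multivariateGaussian 0 S) := by
  have hmul : CFC.sqrt S * CFC.sqrt S = S := CFC.sqrt_mul_sqrt_self _ hS.posSemidef.nonneg
  have hunit : IsUnit (CFC.sqrt S) :=
    ((Commute.refl (CFC.sqrt S)).isUnit_mul_iff.1 (hmul.symm ▸ hS.isUnit)).1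
  have hdet := (Matrix.isUnit_iff_isUnit_det _).1 hunit
  let R := Matrix.toEuclideanCLM (𝕜 := ℝ) (CFC.sqrt S)
  let R' := Matrix.toEuclideanCLM (𝕜 := ℝ) (CFC.sqrt S)⁻¹
  have hRR' : R * R' = 1 := by
    rw [← map_mul, Matrix.mul_nonsing_inv _ hdet, map_one]
  have hR'R : R' * R = 1 := by
    rw [← map_mul, Matrix.nonsing_inv_mul _ hdet, map_one]
  have hadj : ContinuousLinearMap.adjoint R = R :=
    IsSelfAdjoint.adjoint_eq ((CFC.sqrt_nonneg S).isSelfAdjoint.map _)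
  refine ⟨R, R', fun x y => ?_, fun x => DFunLike.congr_fun hRR' x, by fun_prop, ?_⟩
  · rw [← ContinuousLinearMap.adjoint_inner_right, hadj]
  · rw [multivariateGaussian, Measure.map_map (by fun_prop) (by fun_prop)]
    have hid : (R' ∘ fun x => 0 + R x) = id := by
      ext1 x
      simpa using DFunLike.congr_fun hR'R x
    exact (congrArg (fun f => Measure.map f _) hid).trans Measure.map_id

/-- The union bound over an `ε / (16 √n)`-net. Each point of the net is bad with probability at
most `2 exp (-2 ε² n / 5)`, and the net has at most `(48 √n / ε) ^ d ≤ n ^ (7 d) ≤ exp (ε² n / 8)`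
points. -/
lemma measureReal_not_strongAntiConcentration_stdGaussian_le {n d : ℕ} {ε : ℝ} (hn : 2 ≤ n)
    (hd : 0 < d) (hε : 0 < ε) (hε1 : ε ≤ 1) {Ω : Type*} [MeasurableSpace Ω] (P : Measure Ω)
    [IsProbabilityMeasure P] (W : Fin n → Ω → EuclideanSpace ℝ (Fin d))
    (hlaw : ∀ i, HasLaw (W i) (stdGaussian (EuclideanSpace ℝ (Fin d))) P) (hind : iIndepFun W P)
    (hnd : 56 * d * Real.log n ≤ ε ^ 2 * n) :
    P.real {ω | ¬ StrongAntiConcentration ε (ε / 4) (fun i => W i ω)}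
      ≤ Real.exp (-(1 / 8 * ε ^ 2 * n)) := by
  have hn2 : (2 : ℝ) ≤ n := by exact_mod_cast hn
  have hd1 : (1 : ℝ) ≤ d := by exact_mod_cast hd
  have hs0 : 0 < √(n : ℝ) := Real.sqrt_pos.2 (by linarith)
  have hs1 : 1 ≤ √(n : ℝ) := Real.one_le_sqrt.2 (by linarith)
  have hlog : 0.69 ≤ Real.log n :=
    (by linarith [Real.log_two_gt_d9] : (0.69 : ℝ) ≤ Real.log 2).trans
      (Real.log_le_log (by norm_num) hn2)
  have hX : 38 ≤ ε ^ 2 * n := by nlinarith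
  have hXn : ε ^ 2 * n ≤ n := mul_le_of_le_one_left (by linarith) (pow_le_one₀ hε.le hε1)
  obtain ⟨N, hNcard, hN1, hNnet⟩ := exists_finset_net_sphere
    (E := EuclideanSpace ℝ (Fin d)) (η := ε / (16 * √(n : ℝ))) (by positivity)
    (by rw [div_le_one (by positivity)]; linarith)
  have hcard : (N.card : ℝ) ≤ Real.exp (1 / 8 * (ε ^ 2 * n)) := by
    have hbase : 3 / (ε / (16 * √(n : ℝ))) ≤ Real.exp (7 * Real.log n) := by
      have hεs : 1 ≤ ε * √(n : ℝ) := by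
        rw [← one_le_sq_iff₀ (by positivity), mul_pow, Real.sq_sqrt (by linarith)]
        linarith
      have hexp : Real.exp (7 * Real.log n) = (n : ℝ) ^ 7 := by
        rw [mul_comm, Real.exp_mul, Real.exp_log (by linarith)]
        norm_cast
      rw [hexp]
      calc 3 / (ε / (16 * √(n : ℝ))) = 48 * √(n : ℝ) / ε := by field_simp; norm_num
        _ ≤ 48 * n := by
          rw [div_le_iff₀ hε]
          nlinarith [Real.mul_self_sqrt (by linarith : (0 : ℝ) ≤ n)]
        _ ≤ (n : ℝ) ^ 6 * n := by
          gcongr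
          exact (by norm_num : (48 : ℝ) ≤ 2 ^ 6).trans (pow_le_pow_left₀ (by norm_num) hn2 6)
        _ = (n : ℝ) ^ 7 := by ring
    rw [finrank_euclideanSpace_fin] at hNcard
    refine hNcard.trans ((pow_le_pow_left₀ (by positivity) hbase d).trans ?_)
    rw [← Real.exp_nat_mul]
    exact Real.exp_le_exp.2 (by linarith)
  let B₁ : EuclideanSpace ℝ (Fin d) → Set Ω := fun γ =>
    {ω | 3 * (n : ℝ) ≤ ∑ i, inner ℝ (W i ω) γ ^ 2}
  let B₂ : EuclideanSpace ℝ (Fin d) → Set Ω := fun γ =>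
    {ω | (ε / 2 + ε / 2) * n ≤ ({i | inner ℝ (W i ω) γ ∈ {x : ℝ | |x| < 5 / 8 * ε}}.ncard : ℝ)}
  have hsub : {ω | ¬ StrongAntiConcentration ε (ε / 4) (fun i => W i ω)}
      ⊆ ⋃ γ ∈ N, (B₁ γ ∪ B₂ γ) := by
    intro ω hω
    by_contra hcon
    simp only [Set.mem_iUnion, Set.mem_union, not_exists, not_or] at hcon
    refine hω (strongAntiConcentration_of_net (by omega) hε hε1 _ N hNnet
      (fun γ hγ => ?_) fun γ hγ => ?_)
    · exact (not_le.1 (hcon γ hγ).1).le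
    · have h : ¬ (ε / 2 + ε / 2) * n ≤ ({i | |inner ℝ (W i ω) γ| < 5 / 8 * ε}.ncard : ℝ) :=
        (hcon γ hγ).2
      rw [add_halves] at h
      exact (not_le.1 h).le
  have hbad : ∀ γ ∈ N, P.real (B₁ γ ∪ B₂ γ) ≤ 2 * Real.exp (-(2 / 5 * (ε ^ 2 * n))) := by
    intro γ hγ
    have hlawγ : ∀ i, HasLaw (fun ω => inner ℝ (W i ω) γ) (gaussianReal 0 1) P := fun i =>
      (hasLaw_inner_stdGaussian (hN1 γ hγ)).fun_comp (hlaw i)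
    have hindγ : iIndepFun (fun i ω => (inner ℝ (W i ω) γ : ℝ)) P :=
      hind.comp (fun _ x => inner ℝ x γ) fun _ => by fun_prop
    have hmeas : MeasurableSet {x : ℝ | |x| < 5 / 8 * ε} :=
      measurableSet_lt (by fun_prop) (by fun_prop)
    have h₁ : P.real (B₁ γ) ≤ Real.exp (-(2 / 5 * (ε ^ 2 * n))) :=
      (measureReal_sum_sq_gaussian_ge_le hlawγ hindγ).trans (Real.exp_le_exp.2 (by linarith))
    have h₂ : P.real (B₂ γ) ≤ Real.exp (-(2 / 5 * (ε ^ 2 * n))) := by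
      refine (measureReal_ncard_ge_le hindγ (fun i => (hlawγ i).aemeasurable) hmeas
        (fun i => ?_) (by positivity)).trans (Real.exp_le_exp.2 (by nlinarith))
      rw [(hlawγ i).measureReal_eq (p := fun x => x ∈ {x : ℝ | |x| < 5 / 8 * ε}) hmeas]
      exact (gaussianReal_real_abs_lt_le (by positivity)).trans_eq (by ring)
    linarith [measureReal_union_le (μ := P) (B₁ γ) (B₂ γ)]
  have htwo : (2 : ℝ) ≤ Real.exp (3 / 20 * (ε ^ 2 * n)) := by
    linarith [Real.add_one_le_exp (3 / 20 * (ε ^ 2 * n))]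
  calc P.real {ω | ¬ StrongAntiConcentration ε (ε / 4) (fun i => W i ω)}
      ≤ P.real (⋃ γ ∈ N, (B₁ γ ∪ B₂ γ)) := measureReal_mono hsub (measure_ne_top _ _)
    _ ≤ ∑ γ ∈ N, P.real (B₁ γ ∪ B₂ γ) := measureReal_biUnion_finset_le _ _
    _ ≤ N.card * (2 * Real.exp (-(2 / 5 * (ε ^ 2 * n)))) := by
      rw [← nsmul_eq_mul]
      exact Finset.sum_le_card_nsmul _ _ _ hbad
    _ ≤ Real.exp (1 / 8 * (ε ^ 2 * n)) * (Real.exp (3 / 20 * (ε ^ 2 * n))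
        * Real.exp (-(2 / 5 * (ε ^ 2 * n)))) := by gcongr
    _ = Real.exp (-(1 / 8 * ε ^ 2 * n)) := by
      rw [← Real.exp_add, ← Real.exp_add]
      ring_nf

theorem mainTheorem6 :
    ∃ C : ℝ, 0 < C ∧ ∃ c : ℝ, 0 < c ∧
      ∀ (n d : ℕ) (ε : ℝ), 0 < n → 0 < d → 0 < ε →
      ∀ S : Matrix (Fin d) (Fin d) ℝ, S.PosDef →
      ∀ (Ω : Type*) [MeasurableSpace Ω] (P : Measure Ω) [IsProbabilityMeasure P]
        (Z : Fin n → Ω → EuclideanSpace ℝ (Fin d)),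
        (∀ i, HasLaw (Z i) (multivariateGaussian 0 S) P) →
        iIndepFun Z P →
        C * d * Real.log n / ε ^ 2 ≤ n →
        1 - Real.exp (-(c * ε ^ 2 * n)) ≤
          P.real {ω | StrongAntiConcentration ε (ε / 4) (fun i => Z i ω)} := by
  refine ⟨56, by norm_num, 1 / 8, by norm_num, ?_⟩
  intro n d ε hn hd hε S hS Ω _ P _ Z hlaw hind hnd
  have hsure : (∀ ω, StrongAntiConcentration ε (ε / 4) (fun i => Z i ω)) →
      1 - Real.exp (-(1 / 8 * ε ^ 2 * n)) ≤
        P.real {ω | StrongAntiConcentration ε (ε / 4) (fun i => Z i ω)} := fun h => by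
    have huniv : {ω | StrongAntiConcentration ε (ε / 4) (fun i => Z i ω)} = Set.univ :=
      Set.eq_univ_of_forall h
    rw [huniv, probReal_univ]
    linarith [Real.exp_pos (-(1 / 8 * ε ^ 2 * n))]
  rcases le_total 1 ε with hε1 | hε1
  · exact hsure fun ω => strongAntiConcentration_of_one_le hε1 _
  -- for `n = 1` the sample size condition is void, since `log 1 = 0`
  rcases (show n = 1 ∨ 2 ≤ n by omega) with rfl | hn2
  · exact hsure fun ω => strongAntiConcentration_one hε.le (by linarith) _
  rw [div_le_iff₀ (by positivity), mul_comm (n : ℝ)] at hnd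
  obtain ⟨R, R', hsymm, hRR', hR'⟩ := exists_whitening hS
  have hfail := measureReal_not_strongAntiConcentration_stdGaussian_le hn2 hd hε hε1 P
    (fun i ω => R' (Z i ω)) (fun i => hR'.fun_comp (hlaw i))
    (hind.comp (fun _ => R') fun _ => by fun_prop) hnd
  -- subadditivity of the outer measure: no measurability of the event is needed
  have hcover : 1 ≤ P.real {ω | StrongAntiConcentration ε (ε / 4) (fun i => Z i ω)}
      + P.real {ω | ¬ StrongAntiConcentration ε (ε / 4) (fun i => R' (Z i ω))} := by
    refine le_trans ?_ (measureReal_union_le _ _)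
    rw [← probReal_univ (μ := P)]
    refine measureReal_mono fun ω _ => ?_
    by_cases h : StrongAntiConcentration ε (ε / 4) (fun i => R' (Z i ω))
    · exact Or.inl (h.of_inner_eq R fun i β => by rw [← hsymm, hRR'])
    · exact Or.inr h
  linarith
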